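/- Write points of the plane $\mathbb{R}^3_H=\{\mathbf t\in\mathbb{R}^3: t_1+t_2+t_3=0\}$ in homogeneous coordinates $\mathbf t=(t_1,t_2,t_3)$, and let $$\Omega=\{\mathbf t\in\mathbb{R}^3_H:\ -1\le t_1,\,t_2,\,-t_3<1\}$$ be the regular hexagon. For $n\in\mathbb{N}_0$ let $\mathcal H_n$ be the complex linear span of the functions $\phi_{\mathbf j}(\mathbf t)=e^{\frac{2\pi i}{3}(j_1t_1+j_2t_2+j_3t_3)}$ over all $\mathbf j\in\mathbb{Z}^3$ with $j_1+j_2+j_3=0$ and $-n\le j_1,j_2,j_3\le n$. These formulas define the elements of $\mathcal H_n$ on all of $\mathbb{R}^3$; $\partial_i$ is the partial derivative with respect to $t_i$ there, and, for $\alpha\in\mathbb{N}_0^3$, $\partial^\alpha=\partial_1^{\alpha_1}\partial_2^{\alpha_2}\partial_3^{\alpha_3}$ and $|\alpha|=\alpha_1+\alpha_2+\alpha_3$. Let $\|f\|_p=\left(\int_\Omega|f(\mathbf t)|^p\,d\mathbf t\right)^{1/p}$ with $d\mathbf t=dt_1\,dt_2$ for $1\le p<\infty$, and $\|f\|_\infty=\sup_{\mathbf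 t\in\overline\Omega}|f(\mathbf t)|$. **Theorem (Bernstein inequality).** Let $\alpha\in\mathbb{N}_0^3$ and $1\le p\le\infty$. There is a finite constant $c_p$, depending only on $p$ and $\alpha$, such that for every $n\in\mathbb{N}_0$ $$\|\partial^\alpha S_n\|_p\le c_p\,n^{|\alpha|}\,\|S_n\|_p\qquad\text{for all } S_n\in\mathcal H_n,$$ where $0^0=1$. -/

import Mathlib

open scoped ENNReal NNReal

noncomputable section

namespace HexFourier

/-- The index set `ℍ_n`: integer points `j` with `j₁ + j₂ + j₃ = 0` and `-n ≤ j₁, j₂, j₃ ≤ n`. -/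
def indexSet (n : ℕ) : Set (Fin 3 → ℤ) :=
  {j | j 0 + j 1 + j 2 = 0 ∧ ∀ i, -(n : ℤ) ≤ j i ∧ j i ≤ (n : ℤ)}

/-- The exponential `φ_j(t) = exp((2πi/3) j · t)`, as a function of `t = (t₁, t₂, t₃)`. -/
def phi (j : Fin 3 → ℤ) (t : Fin 3 → ℝ) : ℂ :=
  Complex.exp (2 * (Real.pi : ℂ) * Complex.I / 3 * ∑ i, (j i : ℂ) * (t i : ℂ))

/-- The space `𝓗_n` of hexagonal trigonometric polynomials, the complex span of the `φ_j` with
`j ∈ ℍ_n`. Since `j₁ + j₂ + j₃ = 0`, its elements are constant in the direction `(1, 1, 1)`,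
hence they are determined by their values on the plane `t₁ + t₂ + t₃ = 0`. -/
def trigPoly (n : ℕ) : Submodule ℂ ((Fin 3 → ℝ) → ℂ) :=
  Submodule.span ℂ (phi '' indexSet n)

/-- The partial derivative `∂_i` with respect to the homogeneous coordinate `t_i`. -/
def partialDeriv (i : Fin 3) (f : (Fin 3 → ℝ) → ℂ) (t : Fin 3 → ℝ) : ℂ :=
  lineDeriv ℝ f t (Pi.single i 1)

/-- `∂^α = ∂₁^α₁ ∂₂^α₂ ∂₃^α₃`. -/
def multiDeriv (α : Fin 3 → ℕ) (f : (Fin 3 → ℝ) → ℂ) : (Fin 3 → ℝ) → ℂ :=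
  (partialDeriv 0)^[α 0] ((partialDeriv 1)^[α 1] ((partialDeriv 2)^[α 2] f))

/-- The half-open regular hexagon `Ω` in homogeneous coordinates. -/
def hexagon : Set (Fin 3 → ℝ) :=
  {t | t 0 + t 1 + t 2 = 0 ∧ (-1 ≤ t 0 ∧ t 0 < 1) ∧ (-1 ≤ t 1 ∧ t 1 < 1) ∧
    (-1 ≤ -t 2 ∧ -t 2 < 1)}

/-- The point of the plane `t₁ + t₂ + t₃ = 0` with given first two coordinates. -/
def homPoint (u : ℝ × ℝ) : Fin 3 → ℝ := ![u.1, u.2, -u.1 - u.2]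

/-- The norm of `L^p(Ω)`: `(∫_Ω |f(t)|^p dt)^(1/p)` with `dt = dt₁ dt₂` for `1 ≤ p < ∞`, and the
uniform norm on the closed hexagon for `p = ∞`. -/
def hexNorm (p : ℝ≥0∞) (f : (Fin 3 → ℝ) → ℂ) : ℝ≥0∞ :=
  if p = ∞ then ⨆ t ∈ closure hexagon, ‖f t‖ₑ
  else (∫⁻ u in homPoint ⁻¹' hexagon, ‖f (homPoint u)‖ₑ ^ p.toReal) ^ (1 / p.toReal)

end HexFourier

end

open scoped ENNReal NNReal

namespace HexFourier

/-! Along the direction of `t_i`, an element of `trigPoly n` has frequencies `j i` with `|j i| ≤ n`.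
A Riesz-type formula writes `m = ∑ w_k exp(2πi m k/N)` for all `|m| ≤ n`, with `∑ ‖w_k‖ ≤ 2n`
(`exists_derivative_quadrature`). Hence `∂_i S` is a combination of translates of `S` with total
weight at most `4πn/3` (`exists_partialDeriv_eq_sum`). The hexagon tiles the plane under the period
lattice, so translation preserves the norm for `p < ∞`; for `p = ∞` every value is attained on the
hexagon. Minkowski's inequality (`hexNorm_sum_translate_le`) bounds one derivative, and iteration
gives the rest. -/

/-! ### Discrete Fejér kernels and the derivative quadrature -/

open Finset in
theorem sum_zpow_root {N : ℕ} {z : ℂ} (hz : IsPrimitiveRoot z N) (m : ℤ) :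
    ∑ k ∈ range N, z ^ (m * k) = if (N : ℤ) ∣ m then (N : ℂ) else 0 := by
  have hpow : ∀ k : ℕ, z ^ (m * k) = (z ^ m) ^ k := fun k => by
    rw [zpow_mul, zpow_natCast]
  simp_rw [hpow]
  split_ifs with h
  · simp [(hz.zpow_eq_one_iff_dvd m).2 h]
  · have h1 : z ^ m ≠ 1 := fun h' => h ((hz.zpow_eq_one_iff_dvd m).1 h')
    have h2 : (z ^ m) ^ N = 1 := by
      rw [← zpow_natCast, ← zpow_mul, mul_comm, zpow_mul, zpow_natCast, hz.pow_eq_one, one_zpow]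
    have := mul_neg_geom_sum (z ^ m) N
    rw [h2, sub_self] at this
    exact (mul_eq_zero.1 this).resolve_left (sub_ne_zero.2 h1.symm)

open Finset in
-- Orthogonality of characters mod `N`: expanding the Fejér product leaves only pairs with `m + l ≡
-- l'`.
theorem sum_zpow_mul_fejer {N n : ℕ} {z : ℂ} (hz : IsPrimitiveRoot z N) (hN : 0 < N)
    (m : ℤ) :
    ∑ k ∈ range N, z ^ (m * k) *
        ((∑ l ∈ range n, z ^ ((l : ℤ) * k)) * ∑ l ∈ range n, z ^ (-(l : ℤ) * k)) =
      N * ∑ l ∈ range n, ∑ l' ∈ range n, if (N : ℤ) ∣ m + l - l' then (1 : ℂ) else 0 := by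
  have hz0 : z ≠ 0 := hz.ne_zero hN.ne'
  simp_rw [sum_mul_sum, mul_sum]
  rw [sum_comm]
  refine sum_congr rfl fun l _ => ?_
  rw [sum_comm]
  refine sum_congr rfl fun l' _ => ?_
  rw [mul_ite, mul_one, mul_zero, ← sum_zpow_root hz]
  refine sum_congr rfl fun k _ => ?_
  rw [← zpow_add₀ hz0, ← zpow_add₀ hz0]
  congr 1
  ring

open Finset in
-- As `|m + l - l'| < N`, there is no aliasing: the congruence forces `l' = m + l`. Truncated
-- subtraction covers `m ≥ n`.
theorem card_pairs_sub_eq (n : ℕ) (N : ℕ) (m : ℤ) (h1 : 0 ≤ m) (h2 : m + n ≤ N) :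
    ∑ l ∈ range n, ∑ l' ∈ range n, (if (N : ℤ) ∣ m + l - l' then (1 : ℂ) else 0) =
      ((n - m.toNat : ℕ) : ℂ) := by
  have key : ∀ l ∈ range n, ∑ l' ∈ range n, (if (N : ℤ) ∣ m + l - l' then (1 : ℂ) else 0) =
      if l < n - m.toNat then 1 else 0 := by
    intro l hl
    have hl := mem_range.1 hl
    have : ∀ l' ∈ range n, (if (N : ℤ) ∣ m + l - l' then (1 : ℂ) else 0) =
        if m.toNat + l = l' then 1 else 0 := by
      intro l' hl'
      have hl' := mem_range.1 hl'
      refine if_congr ⟨fun h => ?_, fun h => ?_⟩ rfl rfl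
      · have := Int.eq_zero_of_abs_lt_dvd h (by rw [abs_lt]; constructor <;> omega)
        omega
      · have : m + l - l' = 0 := by omega
        simp [this]
    rw [sum_congr rfl this, sum_ite_eq]
    refine if_congr ?_ rfl rfl
    rw [mem_range]; omega
  rw [sum_congr rfl key, ← sum_filter, sum_const, nsmul_one]
  congr 1
  rw [show (range n).filter (fun l => l < n - m.toNat) = range (n - m.toNat) by
    ext; simp; omega, card_range]

open Finset in
theorem card_pairs_sub_eq_of_neg (n : ℕ) (N : ℕ) (m : ℤ) (h1 : 0 ≤ m) (h2 : m + n ≤ N) :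
    ∑ l ∈ range n, ∑ l' ∈ range n, (if (N : ℤ) ∣ -m + l - l' then (1 : ℂ) else 0) =
      ((n - m.toNat : ℕ) : ℂ) := by
  rw [← card_pairs_sub_eq n N m h1 h2, sum_comm]
  refine sum_congr rfl fun l _ => sum_congr rfl fun l' _ => if_congr ?_ rfl rfl
  rw [← dvd_neg]
  ring_nf

open Finset in
/-- A quadrature formula which differentiates trigonometric polynomials of degree `n`, its weights
being the values of a modulated Fejér kernel. -/
theorem exists_derivative_quadrature (n : ℕ) :
    ∃ (N : ℕ) (w : ℕ → ℂ), ∑ k ∈ range N, ‖w k‖ ≤ 2 * n ∧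
      ∀ m : ℤ, -n ≤ m → m ≤ n →
        ∑ k ∈ range N, w k * Complex.exp (2 * Real.pi * Complex.I * m * (k / N)) = m := by
  rcases Nat.eq_zero_or_pos n with rfl | hn
  · exact ⟨0, 0, by simp, fun m h1 h2 => by
      have : m = 0 := by simp at h1 h2; omega
      simp [this]⟩
  -- The kernel is tested at frequencies up to `2n` and has degree below `n`; `3n` nodes avoid
  -- aliasing.
  set N := 3 * n with hNdef
  have hN : 0 < N := by omega
  have hNC : (N : ℂ) ≠ 0 := by exact_mod_cast hN.ne'
  have hNR : (N : ℝ) ≠ 0 := by exact_mod_cast hN.ne'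
  set z := Complex.exp (2 * Real.pi * Complex.I / N) with hzdef
  have hz : IsPrimitiveRoot z N := Complex.isPrimitiveRoot_exp N hN.ne'
  have hz0 : z ≠ 0 := hz.ne_zero hN.ne'
  have hz1 : ‖z‖ = 1 := hz.norm'_eq_one hN.ne'
  set F : ℕ → ℂ := fun k =>
    (∑ l ∈ range n, z ^ ((l : ℤ) * k)) * ∑ l ∈ range n, z ^ (-(l : ℤ) * k) with hF
  -- `F` is a squared modulus, so its `ℓ¹` norm is its zero-frequency sum.
  have hFnorm : ∀ k, ((‖F k‖ : ℝ) : ℂ) = F k := by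
    intro k
    have : ∑ l ∈ range n, z ^ (-(l : ℤ) * k) =
        (starRingEnd ℂ) (∑ l ∈ range n, z ^ ((l : ℤ) * k)) := by
      rw [map_sum]
      refine sum_congr rfl fun l _ => ?_
      rw [map_zpow₀, ← Complex.inv_eq_conj hz1, inv_zpow', neg_mul]
    simp only [hF]
    rw [this, Complex.mul_conj, Complex.norm_real, Real.norm_of_nonneg (Complex.normSq_nonneg _)]
  have hFsum : ∑ k ∈ range N, ‖F k‖ = N * n := by
    have h := sum_zpow_mul_fejer (n := n) hz hN 0
    rw [card_pairs_sub_eq n N 0 le_rfl (by omega)] at h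
    have : ((∑ k ∈ range N, ‖F k‖ : ℝ) : ℂ) = ((N * n : ℝ) : ℂ) := by
      push_cast
      rw [sum_congr rfl fun k _ => hFnorm k]
      simpa [hF] using h
    exact_mod_cast this
  refine ⟨N, fun k => (N : ℂ)⁻¹ * ((z ^ (-(n : ℤ) * k) - z ^ ((n : ℤ) * k)) * F k), ?_, ?_⟩
  · have hle : ∀ k ∈ range N, ‖(N : ℂ)⁻¹ * ((z ^ (-(n : ℤ) * k) - z ^ ((n : ℤ) * k)) * F k)‖ ≤
        (N : ℝ)⁻¹ * (2 * ‖F k‖) := by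
      intro k _
      rw [norm_mul, norm_inv, Complex.norm_natCast, norm_mul]
      gcongr
      refine (norm_sub_le _ _).trans ?_
      rw [norm_zpow, norm_zpow, hz1]
      norm_num
    refine (sum_le_sum hle).trans ?_
    rw [← mul_sum, ← mul_sum, hFsum]
    apply le_of_eq
    field_simp
  · intro m h1 h2
    have hexp : ∀ k : ℕ, Complex.exp (2 * Real.pi * Complex.I * m * (k / N)) = z ^ (m * k) := by
      intro k
      rw [hzdef, ← Complex.exp_int_mul]
      congr 1
      push_cast
      ring
    have hsplit : ∀ k ∈ range N,
        (N : ℂ)⁻¹ * ((z ^ (-(n : ℤ) * k) - z ^ ((n : ℤ) * k)) * F k) *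
          Complex.exp (2 * Real.pi * Complex.I * m * (k / N)) =
        (N : ℂ)⁻¹ * (z ^ (-(n - m) * k) * F k - z ^ ((n + m) * k) * F k) := by
      intro k _
      rw [hexp, show -(n - m) * (k : ℤ) = -(n : ℤ) * k + m * k by ring,
        show (n + m) * (k : ℤ) = (n : ℤ) * k + m * k by ring, zpow_add₀ hz0, zpow_add₀ hz0]
      ring
    rw [sum_congr rfl hsplit, ← mul_sum, sum_sub_distrib, sum_zpow_mul_fejer hz hN,
      sum_zpow_mul_fejer hz hN, card_pairs_sub_eq_of_neg n N _ (by omega) (by omega),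
      card_pairs_sub_eq n N _ (by omega) (by omega), ← mul_sub, inv_mul_cancel_left₀ hNC]
    -- The truncated differences are `max m 0` and `max (-m) 0`.
    have : ((n - (n - m).toNat : ℕ) : ℤ) - ((n - (n + m).toNat : ℕ) : ℤ) = m := by omega
    exact_mod_cast this

open MeasureTheory

/-! ### Hexagonal trigonometric polynomials -/

theorem phi_add (j : Fin 3 → ℤ) (t v : Fin 3 → ℝ) : phi j (t + v) = phi j t * phi j v := by
  simp only [phi, ← Complex.exp_add, Fin.sum_univ_three, Pi.add_apply, Complex.ofReal_add]
  ring_nf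

theorem phi_smul_single (j : Fin 3 → ℤ) (i : Fin 3) (s : ℝ) :
    phi j (s • Pi.single i 1) = Complex.exp (2 * Real.pi * Complex.I * (j i) * (s / 3)) := by
  have : ∑ k, (j k : ℂ) * (((s • Pi.single i 1 : Fin 3 → ℝ) k : ℝ) : ℂ) = j i * s := by
    rw [Finset.sum_eq_single i] <;> simp +contextual
  rw [phi, this]
  ring_nf

theorem phi_eq_one_of_sum_eq {j : Fin 3 → ℤ} {v : Fin 3 → ℝ} {m : ℤ}
    (h : ∑ i, (j i : ℝ) * v i = 3 * m) : phi j v = 1 := by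
  have h' : ∑ i, (j i : ℂ) * (v i : ℂ) = 3 * m := by exact_mod_cast congrArg Complex.ofReal h
  rw [phi, h', Complex.exp_eq_one_iff]
  exact ⟨m, by ring⟩

theorem continuous_phi (j : Fin 3 → ℤ) : Continuous (phi j) := by
  unfold phi
  fun_prop

theorem trigPoly_induction {n : ℕ} {P : ((Fin 3 → ℝ) → ℂ) → Prop}
    (hphi : ∀ j ∈ indexSet n, P (phi j)) (hzero : P 0) (hadd : ∀ f g, P f → P g → P (f + g))
    (hsmul : ∀ (c : ℂ) f, P f → P (c • f)) {S : (Fin 3 → ℝ) → ℂ} (hS : S ∈ trigPoly n) : P S :=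
  Submodule.span_induction (p := fun f _ => P f)
    (by rintro _ ⟨j, hj, rfl⟩; exact hphi j hj) hzero
    (fun f g _ _ => hadd f g) (fun c f _ => hsmul c f) hS

theorem continuous_of_mem_trigPoly {n : ℕ} {S : (Fin 3 → ℝ) → ℂ} (hS : S ∈ trigPoly n) :
    Continuous S :=
  trigPoly_induction (fun j _ => continuous_phi j) continuous_zero
    (fun _ _ hf hg => hf.add hg) (fun c _ hf => hf.const_smul c) hS

theorem translate_eq_of_mem_trigPoly {n : ℕ} {v : Fin 3 → ℝ}
    (hv : ∀ j ∈ indexSet n, phi j v = 1) {S : (Fin 3 → ℝ) → ℂ} (hS : S ∈ trigPoly n)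
    (t : Fin 3 → ℝ) : S (t + v) = S t := by
  refine trigPoly_induction (P := fun f => f (t + v) = f t) (fun j hj => ?_) rfl
    (fun f g hf hg => ?_) (fun c f hf => ?_) hS
  · rw [phi_add, hv j hj, mul_one]
  · rw [Pi.add_apply, Pi.add_apply, hf, hg]
  · rw [Pi.smul_apply, Pi.smul_apply, hf]

theorem hasLineDerivAt_phi (j : Fin 3 → ℤ) (i : Fin 3) (t : Fin 3 → ℝ) :
    HasLineDerivAt ℝ (phi j) (2 * Real.pi * Complex.I / 3 * j i * phi j t) t (Pi.single i 1) := by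
  have h : (fun s : ℝ => phi j (t + s • Pi.single i 1)) =
      fun s : ℝ => phi j t * Complex.exp (2 * Real.pi * Complex.I * (j i) * ((s : ℂ) / 3)) := by
    funext s
    rw [phi_add, phi_smul_single]
  have h1 : HasDerivAt (fun s : ℝ => 2 * Real.pi * Complex.I * (j i) * ((s : ℂ) / 3))
      (2 * Real.pi * Complex.I * (j i) * (1 / 3)) 0 :=
    (((hasDerivAt_id (0 : ℝ)).ofReal_comp).div_const 3).const_mul _
  have h2 := (h1.cexp).const_mul (phi j t)
  unfold HasLineDerivAt
  rw [h]
  refine h2.congr_deriv ?_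
  simp only [Complex.ofReal_zero, zero_div, mul_zero, Complex.exp_zero]
  ring

/-- Differentiability is carried through the induction because `lineDeriv` need not be additive
without it. -/
theorem partialDeriv_mem_trigPoly {n : ℕ} (i : Fin 3) {S : (Fin 3 → ℝ) → ℂ}
    (hS : S ∈ trigPoly n) :
    partialDeriv i S ∈ trigPoly n ∧
      ∀ t, HasLineDerivAt ℝ S (partialDeriv i S t) t (Pi.single i 1) := by
  refine trigPoly_induction
    (P := fun f => partialDeriv i f ∈ trigPoly n ∧
      ∀ t, HasLineDerivAt ℝ f (partialDeriv i f t) t (Pi.single i 1))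
    (fun j hj => ?_) ?_ (fun f g hf hg => ?_) (fun c f hf => ?_) hS
  · have h : partialDeriv i (phi j) = (2 * Real.pi * Complex.I / 3 * j i : ℂ) • phi j :=
      funext fun t => (hasLineDerivAt_phi j i t).lineDeriv
    exact ⟨h ▸ Submodule.smul_mem _ _ (Submodule.subset_span ⟨j, hj, rfl⟩),
      fun t => h ▸ hasLineDerivAt_phi j i t⟩
  · have h0 : ∀ t, HasLineDerivAt ℝ (0 : (Fin 3 → ℝ) → ℂ) 0 t (Pi.single i 1) := fun t =>
      hasDerivAt_const _ _
    have h : partialDeriv i (0 : (Fin 3 → ℝ) → ℂ) = 0 := funext fun t => (h0 t).lineDeriv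
    rw [h]
    exact ⟨Submodule.zero_mem _, h0⟩
  · have h0 : ∀ t, HasLineDerivAt ℝ (f + g) (partialDeriv i f t + partialDeriv i g t) t
        (Pi.single i 1) := fun t => HasDerivAt.add (hf.2 t) (hg.2 t)
    have h : partialDeriv i (f + g) = partialDeriv i f + partialDeriv i g :=
      funext fun t => (h0 t).lineDeriv
    exact ⟨h ▸ Submodule.add_mem _ hf.1 hg.1, fun t => h ▸ h0 t⟩
  · have h0 : ∀ t, HasLineDerivAt ℝ (c • f) (c • partialDeriv i f t) t
        (Pi.single i 1) := fun t => HasDerivAt.const_smul c (hf.2 t)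
    have h : partialDeriv i (c • f) = c • partialDeriv i f :=
      funext fun t => (h0 t).lineDeriv
    exact ⟨h ▸ Submodule.smul_mem _ _ hf.1, fun t => h ▸ h0 t⟩

/-- The partial derivatives of a trigonometric polynomial are combinations of its translates. -/
theorem exists_partialDeriv_eq_sum (n : ℕ) :
    ∃ (N : ℕ) (w : ℕ → ℂ) (s : ℕ → ℝ), ∑ k ∈ Finset.range N, ‖w k‖ ≤ 4 * Real.pi / 3 * n ∧
      ∀ (i : Fin 3), ∀ S ∈ trigPoly n, ∀ t,
        partialDeriv i S t = ∑ k ∈ Finset.range N, w k * S (t + s k • Pi.single i 1) := by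
  obtain ⟨N, w, hw, hsum⟩ := exists_derivative_quadrature n
  -- The shift `3k/N` cancels the `1/3` in the exponent of `phi`.
  refine ⟨N, fun k => 2 * Real.pi * Complex.I / 3 * w k, fun k => 3 * (k / N), ?_, ?_⟩
  · have hnorm : ‖(2 * Real.pi * Complex.I / 3 : ℂ)‖ = 2 * Real.pi / 3 := by
      simp [abs_of_pos Real.pi_pos]
    calc ∑ k ∈ Finset.range N, ‖2 * Real.pi * Complex.I / 3 * w k‖
        = 2 * Real.pi / 3 * ∑ k ∈ Finset.range N, ‖w k‖ := by
          rw [Finset.mul_sum]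
          exact Finset.sum_congr rfl fun k _ => by rw [norm_mul, hnorm]
      _ ≤ 2 * Real.pi / 3 * (2 * n) := by gcongr
      _ = _ := by ring
  · intro i S hS t
    refine HasLineDerivAt.lineDeriv (𝕜 := ℝ) (f := S) (x := t) (v := Pi.single i 1) ?_
    refine trigPoly_induction (P := fun f => HasLineDerivAt ℝ f
        (∑ k ∈ Finset.range N, (2 * Real.pi * Complex.I / 3 * w k) *
          f (t + (3 * (k / N : ℝ)) • (Pi.single i 1 : Fin 3 → ℝ))) t (Pi.single i 1))
      (fun j hj => ?_) ?_ (fun f g hf hg => ?_) (fun c f hf => ?_) hS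
    · refine HasDerivAt.congr_deriv (hasLineDerivAt_phi j i t) ?_
      rw [← hsum (j i) (hj.2 i).1 (hj.2 i).2, Finset.mul_sum, Finset.sum_mul]
      refine Finset.sum_congr rfl fun k _ => ?_
      rw [phi_add, phi_smul_single]
      push_cast
      rw [mul_div_cancel_left₀ _ (three_ne_zero' ℂ)]
      ring
    · refine HasDerivAt.congr_deriv (hasDerivAt_const (0 : ℝ) (0 : ℂ)) ?_
      simp
    · refine HasDerivAt.congr_deriv (HasDerivAt.add hf hg) ?_
      simp only [Pi.add_apply, mul_add, Finset.sum_add_distrib]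
    · refine HasDerivAt.congr_deriv (HasDerivAt.const_smul c hf) ?_
      simp only [Pi.smul_apply, smul_eq_mul, Finset.mul_sum]
      exact Finset.sum_congr rfl fun k _ => by ring

/-! ### Translation invariance of the norms -/

/-- The lattice of periods of the hexagonal trigonometric polynomials, in the first two
homogeneous coordinates. -/
def periodLattice : AddSubgroup (ℝ × ℝ) :=
  AddMonoidHom.range
    (AddMonoidHom.mk' (fun a : ℤ × ℤ => ((2 * a.1 - a.2, 2 * a.2 - a.1) : ℝ × ℝ))
      (by intro a b; ext <;> simp <;> ring))

theorem mem_periodLattice {u : ℝ × ℝ} :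
    u ∈ periodLattice ↔ ∃ a b : ℤ, u = (2 * (a : ℝ) - b, 2 * (b : ℝ) - a) := by
  simp [periodLattice, AddMonoidHom.mem_range, eq_comm]

instance : Countable periodLattice :=
  (Set.countable_range fun a : ℤ × ℤ =>
    ((2 * a.1 - a.2, 2 * a.2 - a.1) : ℝ × ℝ)).to_subtype

theorem homPoint_mem_hexagon {u : ℝ × ℝ} : homPoint u ∈ hexagon ↔
    (-1 ≤ u.1 ∧ u.1 < 1) ∧ (-1 ≤ u.2 ∧ u.2 < 1) ∧ -1 ≤ u.1 + u.2 ∧ u.1 + u.2 < 1 := by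
  simp only [hexagon, homPoint, Set.mem_ofPred_eq, Matrix.cons_val]
  constructor
  · rintro ⟨_, h⟩
    refine ⟨h.1, h.2.1, by linarith, by linarith⟩
  · rintro h
    refine ⟨by ring, h.1, h.2.1, by linarith, by linarith⟩

theorem measurableSet_homPoint_preimage_hexagon : MeasurableSet (homPoint ⁻¹' hexagon) := by
  have : homPoint ⁻¹' hexagon = {u : ℝ × ℝ | (-1 ≤ u.1 ∧ u.1 < 1) ∧ (-1 ≤ u.2 ∧ u.2 < 1) ∧
      -1 ≤ u.1 + u.2 ∧ u.1 + u.2 < 1} := Set.ext fun u => homPoint_mem_hexagon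
  rw [this]
  measurability

theorem existsUnique_add_mem_hexagon (u : ℝ × ℝ) :
    ∃! g : periodLattice, homPoint ((g : ℝ × ℝ) + u) ∈ hexagon := by
  simp_rw [homPoint_mem_hexagon]
  refine existsUnique_of_exists_of_unique ?_ ?_
  · suffices h : ∃ a b : ℤ, (-1 ≤ 2 * (a : ℝ) - b + u.1 ∧ 2 * (a : ℝ) - b + u.1 < 1) ∧
        (-1 ≤ 2 * (b : ℝ) - a + u.2 ∧ 2 * (b : ℝ) - a + u.2 < 1) ∧
        -1 ≤ 2 * (a : ℝ) - b + u.1 + (2 * (b : ℝ) - a + u.2) ∧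
        2 * (a : ℝ) - b + u.1 + (2 * (b : ℝ) - a + u.2) < 1 by
      obtain ⟨a, b, h⟩ := h
      exact ⟨⟨_, mem_periodLattice.2 ⟨a, b, rfl⟩⟩, h⟩
    -- Coordinates in the lattice basis `(2, -1)`, `(-1, 2)`. The cases below decide which of the
    -- four corners of the unit cell is the centre of the hexagon containing the point.
    obtain ⟨x, y, hx⟩ : ∃ x y : ℝ, u = (2 * x - y, 2 * y - x) :=
      ⟨(2 * u.1 + u.2) / 3, (u.1 + 2 * u.2) / 3, by ext <;> simp <;> ring⟩
    subst hx
    have h1 := Int.floor_le x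
    have h2 := Int.lt_floor_add_one x
    have h3 := Int.floor_le y
    have h4 := Int.lt_floor_add_one y
    by_cases c1 : 2 * (x - ⌊x⌋) - (y - ⌊y⌋) < 1
    · by_cases c2 : 2 * (y - ⌊y⌋) - (x - ⌊x⌋) < 1
      · by_cases c3 : (x - ⌊x⌋) + (y - ⌊y⌋) < 1
        · exact ⟨-⌊x⌋, -⌊y⌋, by push_cast; refine ⟨⟨?_, ?_⟩, ⟨?_, ?_⟩, ?_, ?_⟩ <;> linarith⟩
        · exact ⟨-⌊x⌋ - 1, -⌊y⌋ - 1, by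
            push_cast; refine ⟨⟨?_, ?_⟩, ⟨?_, ?_⟩, ?_, ?_⟩ <;> linarith⟩
      · by_cases c3 : 2 * (x - ⌊x⌋) < (y - ⌊y⌋)
        · exact ⟨-⌊x⌋, -⌊y⌋ - 1, by
            push_cast; refine ⟨⟨?_, ?_⟩, ⟨?_, ?_⟩, ?_, ?_⟩ <;> linarith⟩
        · exact ⟨-⌊x⌋ - 1, -⌊y⌋ - 1, by
            push_cast; refine ⟨⟨?_, ?_⟩, ⟨?_, ?_⟩, ?_, ?_⟩ <;> linarith⟩
    · by_cases c3 : 2 * (y - ⌊y⌋) < (x - ⌊x⌋)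
      · exact ⟨-⌊x⌋ - 1, -⌊y⌋, by
          push_cast; refine ⟨⟨?_, ?_⟩, ⟨?_, ?_⟩, ?_, ?_⟩ <;> linarith⟩
      · exact ⟨-⌊x⌋ - 1, -⌊y⌋ - 1, by
          push_cast; refine ⟨⟨?_, ?_⟩, ⟨?_, ?_⟩, ?_, ?_⟩ <;> linarith⟩
  · rintro ⟨g, hg⟩ ⟨g', hg'⟩ h h'
    obtain ⟨a, b, rfl⟩ := mem_periodLattice.1 hg
    obtain ⟨a', b', rfl⟩ := mem_periodLattice.1 hg'
    simp only [Prod.fst_add, Prod.snd_add] at h h'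
    obtain ⟨⟨h1, h2⟩, ⟨h3, h4⟩, h5, h6⟩ := h
    obtain ⟨⟨h1', h2'⟩, ⟨h3', h4'⟩, h5', h6'⟩ := h'
    -- The two lattice coordinates of the difference and their sum lie in `{-1, 0, 1}`. The
    -- coordinates are congruent mod 3, hence equal, and the bound on the sum makes them zero.
    have e1 : 2 * (a - a') - (b - b') < 2 := by
      have : (2 * (a - a') - (b - b') : ℝ) < 2 := by linarith
      exact_mod_cast this
    have e2 : -2 < 2 * (a - a') - (b - b') := by
      have : -2 < (2 * (a - a') - (b - b') : ℝ) := by linarith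
      exact_mod_cast this
    have e3 : 2 * (b - b') - (a - a') < 2 := by
      have : (2 * (b - b') - (a - a') : ℝ) < 2 := by linarith
      exact_mod_cast this
    have e4 : -2 < 2 * (b - b') - (a - a') := by
      have : -2 < (2 * (b - b') - (a - a') : ℝ) := by linarith
      exact_mod_cast this
    have e5 : (a - a') + (b - b') < 2 := by
      have : ((a - a') + (b - b') : ℝ) < 2 := by linarith
      exact_mod_cast this
    have e6 : -2 < (a - a') + (b - b') := by
      have : -2 < ((a - a') + (b - b') : ℝ) := by linarith
      exact_mod_cast this
    obtain rfl : a = a' := by omega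
    obtain rfl : b = b' := by omega
    rfl

theorem isAddFundamentalDomain_hexagon_translate (w : ℝ × ℝ) :
    IsAddFundamentalDomain periodLattice ((· + w) ⁻¹' (homPoint ⁻¹' hexagon)) volume := by
  refine IsAddFundamentalDomain.mk'
    (measurableSet_homPoint_preimage_hexagon.preimage (measurable_add_const w)).nullMeasurableSet
    fun u => ?_
  simpa [AddSubgroup.vadd_def, add_assoc] using existsUnique_add_mem_hexagon (u + w)

/-- A translated hexagon is again a fundamental domain, and a periodic function has the same
integral over both. -/
theorem setLIntegral_hexagon_translate {F : ℝ × ℝ → ℝ≥0∞}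
    (hF : ∀ (g : periodLattice) (u : ℝ × ℝ), F (g + u) = F u) (w : ℝ × ℝ) :
    ∫⁻ u in homPoint ⁻¹' hexagon, F (u + w) = ∫⁻ u in homPoint ⁻¹' hexagon, F u := by
  have h0 : IsAddFundamentalDomain periodLattice (homPoint ⁻¹' hexagon) volume := by
    simpa using isAddFundamentalDomain_hexagon_translate 0
  rw [h0.setLIntegral_eq (isAddFundamentalDomain_hexagon_translate w) _ fun g u => by
    rw [AddSubgroup.vadd_def, vadd_eq_add, add_assoc, hF]]
  exact (measurePreserving_add_right volume w).setLIntegral_comp_preimage_emb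
    (measurableEmbedding_addRight w) F _

theorem homPoint_add (u w : ℝ × ℝ) : homPoint (u + w) = homPoint u + homPoint w := by
  ext i
  fin_cases i <;> simp [homPoint]
  ring

theorem continuous_homPoint : Continuous homPoint := by
  refine continuous_pi fun i => ?_
  fin_cases i <;> simp [homPoint] <;> fun_prop

theorem homPoint_periodLattice_add {n : ℕ} {S : (Fin 3 → ℝ) → ℂ} (hS : S ∈ trigPoly n)
    (g : periodLattice) (u : ℝ × ℝ) : S (homPoint (g + u)) = S (homPoint u) := by
  obtain ⟨g, hg⟩ := g
  obtain ⟨a, b, rfl⟩ := mem_periodLattice.1 hg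
  rw [add_comm, homPoint_add]
  refine translate_eq_of_mem_trigPoly (fun j hj => ?_) hS _
  refine phi_eq_one_of_sum_eq (m := j 0 * a + j 1 * b) ?_
  have h2 : (j 2 : ℝ) = -j 0 - j 1 := by
    have : j 2 = -j 0 - j 1 := by linarith [hj.1]
    exact_mod_cast this
  simp [Fin.sum_univ_three, homPoint, h2]
  ring

/-- The coordinate directions leave the plane, but `S` is constant along `(1, 1, 1)`, so a shift may
be projected to the plane by subtracting its mean. -/
theorem exists_eq_homPoint {n : ℕ} (v : Fin 3 → ℝ) : ∃ w : ℝ × ℝ, ∀ S ∈ trigPoly n,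
    ∀ t, S (t + v) = S (t + homPoint w) := by
  refine ⟨(v 0 - (v 0 + v 1 + v 2) / 3, v 1 - (v 0 + v 1 + v 2) / 3), fun S hS t => ?_⟩
  set w : ℝ × ℝ := (v 0 - (v 0 + v 1 + v 2) / 3, v 1 - (v 0 + v 1 + v 2) / 3)
  rw [← translate_eq_of_mem_trigPoly (v := v - homPoint w) (fun j hj => ?_) hS (t + homPoint w)]
  · congr 1; abel
  · refine phi_eq_one_of_sum_eq (m := 0) ?_
    have h2 : (j 2 : ℝ) = -j 0 - j 1 := by
      have : j 2 = -j 0 - j 1 := by linarith [hj.1]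
      exact_mod_cast this
    simp [Fin.sum_univ_three, homPoint, h2, w]
    ring

theorem exists_hexagon_eq {n : ℕ} {S : (Fin 3 → ℝ) → ℂ} (hS : S ∈ trigPoly n)
    (t : Fin 3 → ℝ) : ∃ t' ∈ hexagon, S t = S t' := by
  obtain ⟨w, hw⟩ := exists_eq_homPoint (n := n) t
  obtain ⟨g, hg, -⟩ := existsUnique_add_mem_hexagon w
  refine ⟨_, hg, ?_⟩
  rw [homPoint_periodLattice_add hS]
  simpa using hw S hS 0

theorem hexNorm_eq_eLpNorm {p : ℝ≥0∞} (hp : 1 ≤ p) (hp' : p ≠ ∞) (f : (Fin 3 → ℝ) → ℂ) :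
    hexNorm p f = eLpNorm (fun u => f (homPoint u)) p
      (volume.restrict (homPoint ⁻¹' hexagon)) := by
  rw [hexNorm, if_neg hp', eLpNorm_eq_lintegral_rpow_enorm_toReal (by positivity) hp']

theorem hexNorm_translate {n : ℕ} {p : ℝ≥0∞} (hp' : p ≠ ∞) {S : (Fin 3 → ℝ) → ℂ}
    (hS : S ∈ trigPoly n) (v : Fin 3 → ℝ) : hexNorm p (fun t => S (t + v)) = hexNorm p S := by
  obtain ⟨w, hw⟩ := exists_eq_homPoint (n := n) v
  simp only [hexNorm, if_neg hp', hw S hS, ← homPoint_add]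
  rw [setLIntegral_hexagon_translate (F := fun u => ‖S (homPoint u)‖ₑ ^ p.toReal)
    (fun g u => by simp only [homPoint_periodLattice_add hS])]

/-- Minkowski's inequality for a combination of translates. -/
theorem hexNorm_sum_translate_le {n : ℕ} {p : ℝ≥0∞} (hp : 1 ≤ p) {S : (Fin 3 → ℝ) → ℂ}
    (hS : S ∈ trigPoly n) (N : ℕ) (w : ℕ → ℂ) (v : ℕ → Fin 3 → ℝ) :
    hexNorm p (fun t => ∑ k ∈ Finset.range N, w k * S (t + v k)) ≤
      (∑ k ∈ Finset.range N, ‖w k‖ₑ) * hexNorm p S := by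
  rw [Finset.sum_mul]
  by_cases hp' : p = ∞
  · subst hp'
    simp only [hexNorm, if_pos]
    refine iSup₂_le fun t _ => (enorm_sum_le _ _).trans (Finset.sum_le_sum fun k _ => ?_)
    rw [enorm_mul]
    gcongr
    obtain ⟨t', ht', h⟩ := exists_hexagon_eq hS (t + v k)
    rw [h]
    exact le_iSup₂ (f := fun t (_ : t ∈ closure hexagon) => ‖S t‖ₑ) t' (subset_closure ht')
  · have hmeas : ∀ k ∈ Finset.range N, AEStronglyMeasurable
        (w k • fun u => S (homPoint u + v k)) (volume.restrict (homPoint ⁻¹' hexagon)) :=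
      fun k _ => (((continuous_of_mem_trigPoly hS).comp
        (continuous_homPoint.add continuous_const)).const_smul (w k)).aestronglyMeasurable
    have hsum : (fun u => ∑ k ∈ Finset.range N, w k * S (homPoint u + v k)) =
        ∑ k ∈ Finset.range N, w k • fun u => S (homPoint u + v k) := by
      ext u
      simp [Finset.sum_apply]
    rw [hexNorm_eq_eLpNorm hp hp', hsum]
    refine (eLpNorm_sum_le hmeas hp).trans (Finset.sum_le_sum fun k _ => ?_)
    rw [eLpNorm_const_smul, ← hexNorm_translate hp' hS (v k), hexNorm_eq_eLpNorm hp hp']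

/-! ### The Bernstein inequality -/

theorem hexNorm_partialDeriv_le {n : ℕ} {p : ℝ≥0∞} (hp : 1 ≤ p) (i : Fin 3)
    {S : (Fin 3 → ℝ) → ℂ} (hS : S ∈ trigPoly n) :
    hexNorm p (partialDeriv i S) ≤ ENNReal.ofReal (4 * Real.pi / 3) * n * hexNorm p S := by
  obtain ⟨N, w, s, hw, h⟩ := exists_partialDeriv_eq_sum n
  rw [show partialDeriv i S = _ from funext (h i S hS)]
  refine (hexNorm_sum_translate_le hp hS N w _).trans ?_
  gcongr
  calc ∑ k ∈ Finset.range N, ‖w k‖ₑ = ENNReal.ofReal (∑ k ∈ Finset.range N, ‖w k‖) := by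
        rw [ENNReal.ofReal_sum_of_nonneg fun _ _ => norm_nonneg _]
        simp only [ofReal_norm]
    _ ≤ ENNReal.ofReal (4 * Real.pi / 3 * n) := ENNReal.ofReal_le_ofReal hw
    _ = _ := by rw [ENNReal.ofReal_mul (by positivity), ENNReal.ofReal_natCast]

theorem hexNorm_iterate_partialDeriv_le {n : ℕ} {p : ℝ≥0∞} (hp : 1 ≤ p) (i : Fin 3) (m : ℕ)
    {S : (Fin 3 → ℝ) → ℂ} (hS : S ∈ trigPoly n) :
    (partialDeriv i)^[m] S ∈ trigPoly n ∧ hexNorm p ((partialDeriv i)^[m] S) ≤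
      (ENNReal.ofReal (4 * Real.pi / 3) * n) ^ m * hexNorm p S := by
  induction m with
  | zero => simpa using hS
  | succ m ih =>
    rw [Function.iterate_succ_apply']
    refine ⟨(partialDeriv_mem_trigPoly i ih.1).1, (hexNorm_partialDeriv_le hp i ih.1).trans ?_⟩
    rw [pow_succ', mul_assoc _ _ (hexNorm p S)]
    gcongr
    exact ih.2

end HexFourier

theorem theorem4p8 (α : Fin 3 → ℕ) (p : ℝ≥0∞) (hp : 1 ≤ p) :
    ∃ c : ℝ≥0, ∀ (n : ℕ), ∀ S ∈ HexFourier.trigPoly n,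
      HexFourier.hexNorm p (HexFourier.multiDeriv α S) ≤
        (c : ℝ≥0∞) * (n : ℝ≥0∞) ^ (∑ i, α i) * HexFourier.hexNorm p S := by
  -- One factor `4π/3` per derivative; the constant does not depend on `p`.
  refine ⟨(4 * Real.pi / 3).toNNReal ^ (∑ i, α i), fun n S hS => ?_⟩
  have h2 := HexFourier.hexNorm_iterate_partialDeriv_le hp 2 (α 2) hS
  have h1 := HexFourier.hexNorm_iterate_partialDeriv_le hp 1 (α 1) h2.1
  have h0 := HexFourier.hexNorm_iterate_partialDeriv_le hp 0 (α 0) h1.1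
  calc _ ≤ _ := h0.2
    _ ≤ (ENNReal.ofReal (4 * Real.pi / 3) * n) ^ α 0 *
        ((ENNReal.ofReal (4 * Real.pi / 3) * n) ^ α 1 *
          ((ENNReal.ofReal (4 * Real.pi / 3) * n) ^ α 2 * HexFourier.hexNorm p S)) := by
      gcongr
      exact h1.2.trans (by gcongr; exact h2.2)
    _ = _ := by
      rw [ENNReal.coe_pow, ← mul_pow, Fin.sum_univ_three, pow_add, pow_add, ← mul_assoc,
        ← mul_assoc]
      rfl
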